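/- All matroids are finite. A matroid $\mathcal{M}$ on a ground set $E$ is \emph{regular} if it is the column matroid over $\mathbb{R}$ of a totally unimodular integer matrix $A$ with $r$ rows, columns labelled by $E$, and rank $r$ (for some $r\ge 0$); such an $A$ is called a totally unimodular representation of $\mathcal{M}$. For a matrix $A$ of this kind, the lattice of integer flows is $\Lambda(A)=\ker(A)\cap\mathbb{Z}^{E}$ with the bilinear form induced by the dot product on $\mathbb{Z}^{E}$. Two lattices are \emph{isometric} if there is an isomorphism of abelian groups between them that preserves the bilinear forms. For a matroid $\mathcal{M}$, let $\mathcal{M}_\bullet$ be the minor of $\mathcal{M}$ obtained by contracting all co-loops of $\mathcal{M}$. Two matroids are \emph{isomorphic} if there is a bijection between their ground sets that preserves independence in both directions. \textbf{Theorem.} Let $\mathcal{M}$ and $\mathcal{N}$ be regular matroids. For any totally unimodular representation $A$ of $\mathcal{M}$ and any totally unimodular representation $B$ of $\mathcal{N}$, put $\Lambda(\mathcal{M})=\Lambda(A)$ and $\Lambda(\mathcal{N})=\Lambda(B)$. Then $\Lambda(\mathcal{M})$ and $\Lambda(\mathcal{N})$ are isometric if and only if $\mathcal{M}_\bullet$ and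 $\mathcal{N}_\bullet$ are isomorphic. -/

import Mathlib

open scoped Matrix

namespace Matroid

/-- The `r`-by-`E` integer matrix `A` is a totally unimodular matrix of rank `r` whose column
matroid over `ℝ` is `M` (the columns are labelled by the ground set `E` of `M`). -/
structure IsTURepresentation {α : Type*} (M : Matroid α) [Fintype M.E] {r : ℕ}
    (A : Matrix (Fin r) M.E ℤ) : Prop where
  isTotallyUnimodular : A.IsTotallyUnimodular
  rank_eq : (A.map (Int.cast : ℤ → ℝ)).rank = r
  indep_iff : ∀ I : Set M.E, M.Indep (Subtype.val '' I) ↔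
    LinearIndepOn ℝ (fun e : M.E => (A.map (Int.cast : ℤ → ℝ)).col e) I

/-- A finite matroid is regular if it is the column matroid over `ℝ` of some totally unimodular
`r`-by-`E` matrix of rank `r`. -/
def IsRegular {α : Type*} (M : Matroid α) [Fintype M.E] : Prop :=
  ∃ (r : ℕ) (A : Matrix (Fin r) M.E ℤ), M.IsTURepresentation A

/-- The minor of `M` obtained by contracting all coloops. -/
def contractColoops {α : Type*} (M : Matroid α) : Matroid α :=
  M.contract M.coloops

/-- Two matroids are isomorphic if there is a bijection between their ground sets which
preserves independence in both directions. -/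
def IsIsomorphic {α β : Type*} (M : Matroid α) (N : Matroid β) : Prop :=
  ∃ φ : M.E ≃ N.E, ∀ I : Set M.E,
    M.Indep (Subtype.val '' I) ↔ N.Indep (Subtype.val '' (φ '' I))

end Matroid

/-- The lattice of integer flows `ker(A) ∩ ℤ^E` of an integer matrix `A` with columns labelled
by `E`. It carries the restriction of the dot product of `ℤ^E`. -/
def integerFlows {m E : Type*} [Fintype E] (A : Matrix m E ℤ) : AddSubgroup (E → ℤ) where
  carrier := {x | A *ᵥ x = 0}
  zero_mem' := Matrix.mulVec_zero A
  add_mem' := by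
    intro x y hx hy
    simp only [Set.mem_ofPred_eq] at hx hy ⊢
    rw [Matrix.mulVec_add, hx, hy, add_zero]
  neg_mem' := by
    intro x hx
    simp only [Set.mem_ofPred_eq] at hx ⊢
    rw [Matrix.mulVec_neg, hx, neg_zero]

/-- Two lattices `Λ ⊆ ℤ^E` and `Λ' ⊆ ℤ^F`, with the bilinear forms induced by the dot products,
are isometric if there is an isomorphism of abelian groups `Λ ≃ Λ'` preserving these forms. -/
def LatticesIsometric {E F : Type*} [Fintype E] [Fintype F]
    (L : AddSubgroup (E → ℤ)) (L' : AddSubgroup (F → ℤ)) : Prop :=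
  ∃ ψ : L ≃+ L', ∀ x y : L, (ψ x : F → ℤ) ⬝ᵥ (ψ y : F → ℤ) = (x : E → ℤ) ⬝ᵥ (y : E → ℤ)

/-!
A set is independent in a regular matroid exactly when it supports no nonzero integer flow, and the
coloops are the coordinates at which every flow vanishes. The flows form a regular chain group in
the sense of Tutte: every flow is a conformal sum of primitive flows, the elementary flows with
entries in `{0, 1, -1}`.

*From isometries to bijections.* For a primitive flow the `ℓ¹` norm is the squared norm, while in
general it is at most the squared norm. Decomposing into primitive flows, an isometry does not
increase the `ℓ¹` norm, and neither does its inverse. So the sum of the absolute values of the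
coordinate functionals is the same for both lattices. Absolute values of functionals that take the
value `1` and are distinct up to sign are linearly independent, hence the coordinates of the two
lattices match up to sign, which yields a bijection preserving independence.

*From bijections to isometries.* Two regular lattices in `ℤ^E` with the same independent sets differ
by a change of signs of coordinates. One adds the coordinates one at a time. When `e₀` is added to a
set on which the lattices `L` and `L'` agree, each is generated by its vectors vanishing at `e₀` and
one primitive vector, `c` or `c'`, where `c` and `c'` have the same support. No elementary vector
vanishing at `e₀` meets both the part of this support where `c' = c` and the part where `c' = -c`,
so changing the signs on everything connected to the second part sends `c` to `c'` and keeps the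
vectors vanishing at `e₀`.
-/

section RegularLattices

open Function
open scoped Pointwise

variable {E F G : Type*}

/-- Independence in the matroid whose flows form the lattice `L ⊆ ℤ^E`: no nonzero vector of `L`
is supported in `I`. If `L` consists of the integer flows of a matrix, this is independence of the
columns indexed by `I`. -/
def FlowIndep (L : AddSubgroup (E → ℤ)) (I : Set E) : Prop :=
  ∀ x ∈ L, support x ⊆ I → x = 0

/-- Tutte's elementary chains: the nonzero vectors of `L` of minimal support. -/
def IsElementary (L : AddSubgroup (E → ℤ)) (x : E → ℤ) : Prop :=
  MinimalFor (fun y => y ∈ L ∧ y ≠ 0) support x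

/-- The nonzero coordinates of `y` have the same sign as the corresponding coordinates of `x`. -/
def Conforms (y x : E → ℤ) : Prop :=
  ∀ e, y e = 0 ∨ (y e).sign = (x e).sign

/-- Tutte's regular chain groups: every elementary vector is proportional to a `{0, 1, -1}`-vector
of `L`. -/
def IsRegularLattice (L : AddSubgroup (E → ℤ)) : Prop :=
  ∀ x, IsElementary L x → (fun e => (x e).sign) ∈ L

/-- Tutte's primitive chains: the elementary vectors with entries in `{0, 1, -1}`. -/
def IsPrimitive (L : AddSubgroup (E → ℤ)) (c : E → ℤ) : Prop :=
  IsElementary L c ∧ ∀ e, |c e| ≤ 1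

section Elementary

variable {L : AddSubgroup (E → ℤ)} {x y c d : E → ℤ} {e p z : E}

theorem exists_mem_eliminate (hc : c ∈ L) (hd : d ∈ L) (hcp : c p ≠ 0) (hdp : d p = 0)
    (hdz : d z ≠ 0) :
    ∃ w ∈ L, support w ⊆ (support c ∪ support d) \ {z} ∧ w p ≠ 0 := by
  refine ⟨d z • c - c z • d, sub_mem (zsmul_mem hc _) (zsmul_mem hd _), fun e he => ⟨?_, ?_⟩, ?_⟩
  · contrapose! he
    simp_all
  · rintro rfl
    simp [mul_comm] at he
  · simp [hcp, hdp, hdz]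

namespace IsElementary

theorem mem (hy : IsElementary L y) : y ∈ L := hy.prop.1

theorem ne_zero (hy : IsElementary L y) : y ≠ 0 := hy.prop.2

theorem eq_zero_of_support_subset (hy : IsElementary L y) (hx : x ∈ L)
    (hxy : support x ⊆ support y) (hye : y e ≠ 0) (hxe : x e = 0) : x = 0 := by
  by_contra hx0
  exact hy.le_of_le ⟨hx, hx0⟩ hxy hye hxe

theorem of_support_eq (hy : IsElementary L y) (hx : x ∈ L) (hxy : support x = support y) :
    IsElementary L x := by
  refine ⟨⟨hx, ?_⟩, fun w hw => by rw [hxy]; exact hy.2 hw⟩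
  rw [← support_nonempty_iff, hxy]
  exact support_nonempty_iff.2 hy.ne_zero

end IsElementary

theorem exists_isElementary_apply_ne_zero [Finite E] (hx : x ∈ L) (hp : x p ≠ 0) :
    ∃ y, IsElementary L y ∧ support y ⊆ support x ∧ y p ≠ 0 := by
  obtain ⟨y, ⟨hy, hyx, hyp⟩, hmin⟩ := exists_minimalFor_of_wellFoundedLT
    (fun y => y ∈ L ∧ support y ⊆ support x ∧ y p ≠ 0) support ⟨x, hx, subset_rfl, hp⟩
  refine ⟨y, ⟨⟨hy, fun h => hyp (congrFun h p)⟩, fun w ⟨hw, hw0⟩ hwy => ?_⟩, hyx, hyp⟩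
  by_cases hwp : w p = 0
  · obtain ⟨e, he⟩ := ne_iff.1 hw0
    obtain ⟨v, hv, hvy, hvp⟩ := exists_mem_eliminate hy hw hyp hwp he
    rw [Set.union_eq_left.2 hwy] at hvy
    exact absurd rfl (hvy (hmin ⟨hv, (hvy.trans Set.sdiff_subset).trans hyx, hvp⟩
      (hvy.trans Set.sdiff_subset) (hwy he))).2
  · exact hmin ⟨hw, hwy.trans hyx, hwp⟩ hwy

end Elementary

section Conforms

variable {L : AddSubgroup (E → ℤ)} {x y z c : E → ℤ} {e : E}

namespace Conforms

theorem refl (x : E → ℤ) : Conforms x x := fun _ => Or.inr rfl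

theorem support_subset (h : Conforms y x) : support y ⊆ support x := fun e he hx => by
  rcases h e with h | h
  · exact he h
  · exact he (Int.sign_eq_zero_iff_zero.1 (h.trans (by rw [hx, Int.sign_zero])))

theorem trans (hzy : Conforms z y) (hyx : Conforms y x) : Conforms z x := fun e => by
  rcases hzy e with h | h
  · exact Or.inl h
  · rcases hyx e with h' | h'
    · exact Or.inl (Int.sign_eq_zero_iff_zero.1 (by rw [h, h', Int.sign_zero]))
    · exact Or.inr (h.trans h')

end Conforms

theorem add_eq_zero_or_sign_add_eq {u v : ℤ} (h : |u| ≤ |v|) :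
    v + u = 0 ∨ (v + u).sign = v.sign := by
  grind [Int.sign_eq_one_of_pos, Int.sign_eq_neg_one_of_neg, Int.sign_zero]

theorem exists_forall_abs_mul_le [Finite E] (hz : z ≠ 0) (hzy : support z ⊆ support y) :
    ∃ e₁, z e₁ ≠ 0 ∧ ∀ e, |z e| * |y e₁| ≤ |z e₁| * |y e| := by
  obtain ⟨e₀, he₀⟩ := ne_iff.1 hz
  have : Nonempty E := ⟨e₀⟩
  obtain ⟨e₁, he₁⟩ := Finite.exists_max fun e => |(z e : ℚ)| / |(y e : ℚ)|
  have hz₁ : z e₁ ≠ 0 := fun h => by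
    have h₀ : 0 < |(z e₀ : ℚ)| / |(y e₀ : ℚ)| :=
      div_pos (abs_pos.2 (Int.cast_ne_zero.2 he₀)) (abs_pos.2 (Int.cast_ne_zero.2 (hzy he₀)))
    have := he₁ e₀
    simp only [h, Int.cast_zero, abs_zero, zero_div] at this
    exact this.not_gt h₀
  refine ⟨e₁, hz₁, fun e => ?_⟩
  by_cases hye : y e = 0
  · simp [hye, notMem_support.1 fun h => hzy h hye]
  · have := he₁ e
    rw [div_le_div_iff₀ (abs_pos.2 (Int.cast_ne_zero.2 hye))
      (abs_pos.2 (Int.cast_ne_zero.2 (hzy hz₁)))] at this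
    exact_mod_cast this

theorem exists_conforms_add_zsmul [Finite E] (hz : z ≠ 0) (hzy : support z ⊆ support y) :
    ∃ a b : ℤ, 0 < a ∧ Conforms (a • y + b • z) y ∧ ∃ e, y e ≠ 0 ∧ (a • y + b • z) e = 0 := by
  obtain ⟨e₁, hz₁, hmax⟩ := exists_forall_abs_mul_le hz hzy
  have ha : 0 < |z e₁| := abs_pos.2 hz₁
  refine ⟨|z e₁|, -((z e₁).sign * y e₁), ha, fun e => ?_, e₁, hzy hz₁, ?_⟩
  · have hle : |-((z e₁).sign * y e₁) * z e| ≤ |(|z e₁| * y e)| := by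
      rw [abs_mul, abs_neg, abs_mul, Int.abs_sign_of_ne_zero hz₁, one_mul, abs_mul, abs_abs,
        mul_comm |y e₁|]
      exact hmax e
    have hsign : (|z e₁| * y e).sign = (y e).sign := by
      rw [Int.sign_mul, Int.sign_eq_one_of_pos ha, one_mul]
    have := add_eq_zero_or_sign_add_eq hle
    rwa [hsign] at this
  · simp only [Pi.add_apply, Pi.smul_apply, smul_eq_mul]
    linear_combination -(y e₁) * Int.sign_mul_self_eq_abs (z e₁)

theorem exists_isElementary_conforms [Finite E] (hx : x ∈ L) (hx0 : x ≠ 0) :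
    ∃ y, IsElementary L y ∧ Conforms y x := by
  obtain ⟨y, ⟨hy, hy0, hyx⟩, hmin⟩ := exists_minimalFor_of_wellFoundedLT
    (fun y => y ∈ L ∧ y ≠ 0 ∧ Conforms y x) support ⟨x, hx, hx0, Conforms.refl x⟩
  refine ⟨y, ⟨⟨hy, hy0⟩, fun z ⟨hz, hz0⟩ hzy => ?_⟩, hyx⟩
  by_contra hyz
  obtain ⟨e, hye, hze⟩ := Set.not_subset.1 hyz
  obtain ⟨a, b, ha, hw, e₁, hy₁, hw₁⟩ := exists_conforms_add_zsmul hz0 hzy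
  have hwe : (a • y + b • z) e ≠ 0 := by
    simpa [notMem_support.1 hze, ha.ne'] using hye
  exact hmin ⟨add_mem (zsmul_mem hy a) (zsmul_mem hz b), fun h => hwe (congrFun h e),
    hw.trans hyx⟩ hw.support_subset hy₁ hw₁

end Conforms

namespace IsPrimitive

variable {L : AddSubgroup (E → ℤ)} {c x : E → ℤ} {e : E}

theorem abs_apply_of_ne_zero (hc : IsPrimitive L c) (he : c e ≠ 0) : |c e| = 1 :=
  (hc.2 e).antisymm (Int.one_le_abs he)

theorem sum_abs_pos [Fintype E] (hc : IsPrimitive L c) : 0 < ∑ e, |c e| := by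
  obtain ⟨e, he⟩ := ne_iff.1 hc.1.ne_zero
  exact Finset.sum_pos' (fun e _ => abs_nonneg _) ⟨e, Finset.mem_univ e, abs_pos.2 he⟩

theorem abs_apply_eq_add (hc : IsPrimitive L c) (hcx : Conforms c x) (e : E) :
    |x e| = |(x - c) e| + |c e| := by
  obtain h | h | h := Int.abs_le_one_iff.1 (hc.2 e) <;> have := hcx e <;>
    simp only [h, Pi.sub_apply] at this ⊢ <;>
    grind [Int.sign_eq_one_iff_pos, Int.sign_eq_neg_one_iff_neg]

theorem conforms_sub (hc : IsPrimitive L c) (hcx : Conforms c x) :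
    Conforms (x - c) x := fun e => by
  have habs := hc.abs_apply_eq_add hcx e
  have := add_eq_zero_or_sign_add_eq (u := -c e) (v := x e)
    (by rw [abs_neg]; linarith [abs_nonneg ((x - c) e)])
  rwa [← sub_eq_add_neg] at this

theorem sum_abs_eq_add [Fintype E] (hc : IsPrimitive L c) (hcx : Conforms c x) :
    ∑ e, |x e| = ∑ e, |(x - c) e| + ∑ e, |c e| := by
  rw [← Finset.sum_add_distrib]
  exact Finset.sum_congr rfl fun e _ => hc.abs_apply_eq_add hcx e

end IsPrimitive

namespace IsRegularLattice

variable {L : AddSubgroup (E → ℤ)} {c x : E → ℤ} {e : E}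

theorem exists_isPrimitive_of_isElementary (hL : IsRegularLattice L) (hx : IsElementary L x) :
    ∃ c, IsPrimitive L c ∧ support c = support x ∧ Conforms c x := by
  have hsupp : support (fun e => (x e).sign) = support x := by
    ext e; simp
  refine ⟨fun e => (x e).sign, ⟨hx.of_support_eq (hL x hx) hsupp, fun e => ?_⟩, hsupp,
    fun e => Or.inr (Int.sign_sign)⟩
  obtain h | h := eq_or_ne (x e) 0
  · simp [h]
  · exact (Int.abs_sign_of_ne_zero h).le

@[elab_as_elim]
theorem induction_on [Finite E] (hL : IsRegularLattice L) {P : (x : E → ℤ) → x ∈ L → Prop}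
    (zero : P 0 (zero_mem L))
    (step : ∀ (x : E → ℤ) (hx : x ∈ L) (c : E → ℤ) (hc : IsPrimitive L c), Conforms c x →
      P (x - c) (sub_mem hx hc.1.mem) → P x hx)
    {x : E → ℤ} (hx : x ∈ L) : P x hx := by
  have := Fintype.ofFinite E
  induction hn : (∑ e, |x e|).toNat using Nat.strong_induction_on generalizing x with
  | _ n ih =>
    obtain rfl | hx0 := eq_or_ne x 0
    · exact zero
    obtain ⟨y, hy, hyx⟩ := exists_isElementary_conforms hx hx0
    obtain ⟨c, hc, -, hcy⟩ := hL.exists_isPrimitive_of_isElementary hy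
    have hcx := hcy.trans hyx
    refine step x hx c hc hcx (ih _ ?_ (sub_mem hx hc.1.mem) rfl)
    have hsum := hc.sum_abs_eq_add hcx
    have hpos := hc.sum_abs_pos
    have hnonneg : 0 ≤ ∑ e, |(x - c) e| := Finset.sum_nonneg fun e _ => abs_nonneg _
    omega

theorem exists_isPrimitive_apply_ne_zero [Finite E] (hL : IsRegularLattice L) (hx : x ∈ L)
    (he : x e ≠ 0) : ∃ c, IsPrimitive L c ∧ Conforms c x ∧ c e ≠ 0 := by
  induction hx using hL.induction_on with
  | zero => exact absurd rfl he
  | step x _ c hc hcx ih =>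
    by_cases hce : c e = 0
    · obtain ⟨c', hc', hc'x, hc'e⟩ := ih (by simpa [hce] using he)
      exact ⟨c', hc', hc'x.trans (hc.conforms_sub hcx), hc'e⟩
    · exact ⟨c, hc, hcx, hce⟩

theorem exists_apply_eq_one [Finite E] (hL : IsRegularLattice L)
    (he : ∃ x ∈ L, x e ≠ 0) : ∃ x ∈ L, x e = 1 := by
  obtain ⟨x, hx, hxe⟩ := he
  obtain ⟨c, hc, -, hce⟩ := hL.exists_isPrimitive_apply_ne_zero hx hxe
  obtain hc1 | hc1 := eq_or_eq_neg_of_abs_eq (hc.abs_apply_of_ne_zero hce)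
  · exact ⟨c, hc.1.mem, hc1⟩
  · exact ⟨-c, neg_mem hc.1.mem, by rw [Pi.neg_apply, hc1, neg_neg]⟩

end IsRegularLattice

section AbsFunctionals

variable {V ι : Type*} [AddCommGroup G] [AddCommGroup V]

theorem exists_forall_apply_ne_zero [Finite ι] (n : ι → G →+ ℤ) (hn : ∀ i, n i ≠ 0) :
    ∃ x, ∀ i, n i x ≠ 0 := by
  have := Fintype.ofFinite ι
  by_contra! hcover
  obtain ⟨i, -, hi⟩ := Submodule.exists_finiteIndex_of_cover (s := Finset.univ)
    (p := fun i => (n i).toIntLinearMap.ker) (by simpa [Set.iUnion_eq_univ_iff] using hcover)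
  refine hn i (AddMonoidHom.ext fun x => ?_)
  obtain ⟨k, hk, -, hkx⟩ := AddSubgroup.exists_nsmul_mem_of_index_ne_zero hi.index_ne_zero x
  have hkx : k • n i x = 0 := by simpa using hkx
  exact (smul_eq_zero.1 hkx).resolve_left hk.ne'

theorem eq_or_eq_neg_of_ker_le {l n : G →+ ℤ} (hl : ∃ v, l v = 1) (hn : ∃ v, n v = 1)
    (h : l.ker ≤ n.ker) : n = l ∨ n = -l := by
  obtain ⟨v, hv⟩ := hl
  have hmul (x : G) : n x = n v * l x := by
    have hx : x - l x • v ∈ n.ker := h (by simp [AddMonoidHom.mem_ker, hv])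
    rw [AddMonoidHom.mem_ker, map_sub, map_zsmul, smul_eq_mul] at hx
    linarith
  obtain ⟨u, hu⟩ := hn
  rw [hmul u] at hu
  obtain h1 | h1 := Int.isUnit_iff.1 (IsUnit.of_mul_eq_one _ hu)
  · exact Or.inl (AddMonoidHom.ext fun x => by rw [hmul, h1, one_mul])
  · exact Or.inr (AddMonoidHom.ext fun x => by rw [hmul, h1, neg_one_mul, AddMonoidHom.neg_apply])

theorem abs_add_add_abs_sub_of_abs_le {a b : ℤ} (h : |b| ≤ |a|) :
    |a + b| + |a - b| = 2 * |a| := by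
  grind

theorem exists_ker_forall_abs_le [Finite ι] (l : G →+ ℤ) (n : ι → G →+ ℤ)
    (hn : ∀ i, ¬ l.ker ≤ (n i).ker) (v : G) : ∃ q, l q = 0 ∧ ∀ i, |n i v| ≤ |n i q| := by
  have := Fintype.ofFinite ι
  obtain ⟨p, hp⟩ := exists_forall_apply_ne_zero (fun i => (n i).comp l.ker.subtype) fun i h =>
    hn i fun x hx => AddMonoidHom.mem_ker.2 (DFunLike.congr_fun h ⟨x, hx⟩)
  refine ⟨(∑ i, |n i v|) • p, by simp [AddMonoidHom.mem_ker.1 p.2], fun i => ?_⟩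
  have hle : |n i v| ≤ ∑ i, |n i v| :=
    Finset.single_le_sum (f := fun i => |n i v|) (fun _ _ => abs_nonneg _) (Finset.mem_univ i)
  rw [map_zsmul, smul_eq_mul, abs_mul]
  exact (hle.trans (le_abs_self _)).trans
    (le_mul_of_one_le_right (abs_nonneg _) (Int.one_le_abs (hp i)))

theorem linearIndependent_abs (n : ι → G →+ ℤ) (hn : ∀ i, ∃ v, n i v = 1)
    (hne : ∀ i j, n i = n j ∨ n i = -n j → i = j) :
    LinearIndependent ℤ fun i (x : G) => |n i x| := by
  classical
  refine linearIndependent_iff'.2 fun s c hc i hi => ?_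
  have hsum (x : G) : ∑ j ∈ s, c j * |n j x| = 0 := by simpa using congrFun hc x
  -- The second difference along `v` at a generic point `q` of the hyperplane `n i = 0` only sees
  -- the kink of `|n i|`.
  obtain ⟨v, hv⟩ := hn i
  obtain ⟨q, hq, hle⟩ := exists_ker_forall_abs_le (n i) (fun j : s.erase i => n j)
    (fun j h => Finset.ne_of_mem_erase j.2 (hne j i (eq_or_eq_neg_of_ker_le ⟨v, hv⟩ (hn j) h))) v
  have hdiff : ∑ j ∈ s, c j * (|n j (q + v)| + |n j (q - v)| - 2 * |n j q|) = 2 * c i := by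
    rw [Finset.sum_eq_single_of_mem i hi fun j hj hji => ?_]
    · simp [hq, hv, mul_comm, one_add_one_eq_two]
    · rw [map_add, map_sub,
        abs_add_add_abs_sub_of_abs_le (hle ⟨j, Finset.mem_erase.2 ⟨hji, hj⟩⟩), sub_self, mul_zero]
  simp only [mul_sub, mul_add, mul_left_comm _ (2 : ℤ), Finset.sum_sub_distrib,
    Finset.sum_add_distrib, ← Finset.mul_sum, hsum] at hdiff
  linarith

theorem linearIndepOn_abs : LinearIndepOn ℤ id
    {g : G → ℤ | ∃ n : G →+ ℤ, (∃ v, n v = 1) ∧ (fun x => |n x|) = g} := by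
  choose n hn habs using
    fun g : {g : G → ℤ | ∃ n : G →+ ℤ, (∃ v, n v = 1) ∧ (fun x => |n x|) = g} => g.2
  have hind := linearIndependent_abs n hn fun g h hgh => Subtype.ext <| by
    rw [← habs g, ← habs h]
    funext x
    obtain hgh | hgh := hgh <;> simp [hgh]
  rwa [funext habs] at hind

theorem exists_equiv_of_sum_eq [Fintype E] [Fintype F] {S : Set V} (hS : LinearIndepOn ℤ id S)
    {g : E → V} {h : F → V} (hg : ∀ e, g e ∈ S) (hh : ∀ f, h f ∈ S) (hsum : ∑ e, g e = ∑ f, h f) :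
    ∃ φ : E ≃ F, ∀ e, h (φ e) = g e := by
  classical
  have hsupp (e : V) (he : e ∈ S) : Finsupp.single e (1 : ℤ) ∈ Finsupp.supported ℤ ℤ S :=
    Finsupp.single_mem_supported ℤ 1 he
  have hsingle : ∑ e, Finsupp.single (g e) (1 : ℤ) = ∑ f, Finsupp.single (h f) (1 : ℤ) :=
    linearIndepOn_iffₛ.1 hS _ (sum_mem fun e _ => hsupp _ (hg e)) _
      (sum_mem fun f _ => hsupp _ (hh f))
      (by simpa only [map_sum, Finsupp.linearCombination_single, one_smul, id] using hsum)
  have hcard (w : V) : Fintype.card {e // g e = w} = Fintype.card {f // h f = w} := by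
    simpa [Finsupp.single_apply, Finset.sum_boole, Fintype.card_subtype] using
      DFunLike.congr_fun hsingle w
  exact ⟨Equiv.ofFiberEquiv fun w => Fintype.equivOfCardEq (hcard w), Equiv.ofFiberEquiv_map _⟩

end AbsFunctionals

theorem sum_abs_le_dotProduct_self [Fintype F] (y : F → ℤ) : ∑ f, |y f| ≤ y ⬝ᵥ y :=
  Finset.sum_le_sum fun f _ => by
    rw [← abs_mul_abs_self, ← sq]
    exact Int.le_self_sq _

theorem IsPrimitive.sum_abs_eq_dotProduct_self [Fintype E] {L : AddSubgroup (E → ℤ)} {c : E → ℤ}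
    (hc : IsPrimitive L c) : ∑ e, |c e| = c ⬝ᵥ c :=
  Finset.sum_congr rfl fun e _ => by
    obtain h | h | h := Int.abs_le_one_iff.1 (hc.2 e) <;> simp [h]

theorem IsRegularLattice.sum_abs_map_le [Fintype E] [Fintype F] {L : AddSubgroup (E → ℤ)}
    (hL : IsRegularLattice L) (ψ : L →+ (F → ℤ))
    (hψ : ∀ x : L, ψ x ⬝ᵥ ψ x = (x : E → ℤ) ⬝ᵥ (x : E → ℤ)) (x : L) :
    ∑ f, |ψ x f| ≤ ∑ e, |(x : E → ℤ) e| := by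
  obtain ⟨x, hx⟩ := x
  induction hx using hL.induction_on with
  | zero => simp [show (⟨0, zero_mem L⟩ : L) = 0 from rfl]
  | step x hx c hc hcx ih =>
    calc ∑ f, |ψ ⟨x, hx⟩ f|
        = ∑ f, |ψ ⟨x - c, sub_mem hx hc.1.mem⟩ f + ψ ⟨c, hc.1.mem⟩ f| := by
          refine Finset.sum_congr rfl fun f _ => ?_
          rw [← Pi.add_apply, ← map_add, AddMemClass.mk_add_mk]
          simp only [sub_add_cancel]
      _ ≤ ∑ f, |ψ ⟨x - c, sub_mem hx hc.1.mem⟩ f| + ∑ f, |ψ ⟨c, hc.1.mem⟩ f| := by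
          rw [← Finset.sum_add_distrib]
          exact Finset.sum_le_sum fun f _ => abs_add_le _ _
      _ ≤ ∑ e, |(x - c) e| + ∑ e, |c e| := by
          refine add_le_add ih ((sum_abs_le_dotProduct_self _).trans_eq ?_)
          rw [hψ, hc.sum_abs_eq_dotProduct_self]
      _ = ∑ e, |x e| := (hc.sum_abs_eq_add hcx).symm

namespace IsElementary

variable {L : AddSubgroup (E → ℤ)} {c d : E → ℤ} {p q z : E}

theorem exists_eliminate [Finite E] (hc : IsElementary L c) (hd : IsElementary L d)
    (hcp : c p ≠ 0) (hdp : d p = 0) (hdz : d z ≠ 0) :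
    ∃ y, IsElementary L y ∧ support y ⊆ (support c ∪ support d) \ {z} ∧ y p ≠ 0 := by
  obtain ⟨w, hw, hwsub, hwp⟩ := exists_mem_eliminate hc.mem hd.mem hcp hdp hdz
  obtain ⟨y, hy, hyw, hyp⟩ := exists_isElementary_apply_ne_zero hw hwp
  exact ⟨y, hy, hyw.trans hwsub, hyp⟩

theorem exists_apply_ne_zero_and_apply_ne_zero [Finite E] (hc : IsElementary L c)
    (hd : IsElementary L d) (hcd : (support c ∩ support d).Nonempty) (hp : c p ≠ 0) (hq : d q ≠ 0) :
    ∃ y, IsElementary L y ∧ y p ≠ 0 ∧ y q ≠ 0 := by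
  induction hS : support c ∪ support d using WellFoundedLT.induction generalizing c d with
  | _ S ih =>
    subst hS
    by_cases hdp : d p = 0
    swap; · exact ⟨d, hd, hdp, hq⟩
    by_cases hcq : c q = 0
    swap; · exact ⟨c, hc, hp, hcq⟩
    obtain ⟨z, hcz, hdz⟩ := hcd
    obtain ⟨c', hc', hc'sub, hc'p⟩ := hc.exists_eliminate hd hp hdp hdz
    have hmeet : (support c' ∩ support d).Nonempty := by
      by_contra! hdisj
      have hsub : support c' ⊆ support c := fun e he =>
        (hc'sub he).1.resolve_right fun h => (hdisj.subset ⟨he, h⟩).elim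
      exact hc'.ne_zero (hc.eq_zero_of_support_subset hc'.mem hsub hcz
        (notMem_support.1 fun h => (hc'sub h).2 rfl))
    by_cases hlt : support c ⊆ support c' ∪ support d
    swap
    · exact ih _ ⟨Set.union_subset (hc'sub.trans Set.sdiff_subset) Set.subset_union_right,
        fun h => hlt (Set.subset_union_left.trans h)⟩ hc' hd hmeet hc'p hq rfl
    obtain ⟨d', hd', hd'sub, hd'q⟩ := hd.exists_eliminate hc hq hcq hcz
    rw [Set.union_comm] at hd'sub
    obtain ⟨u, hd'u, hdu⟩ : ∃ u ∈ support d', u ∉ support d := by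
      by_contra! hsub
      exact hd'.ne_zero (hd.eq_zero_of_support_subset hd'.mem hsub hdz
        (notMem_support.1 fun h => (hd'sub h).2 rfl))
    have hc'u : u ∈ support c' := (hlt ((hd'sub hd'u).1.resolve_right hdu)).resolve_right hdu
    have hsub := Set.union_subset hc'sub hd'sub
    exact ih _ ⟨hsub.trans Set.sdiff_subset, fun h => (hsub (h (Or.inl hcz))).2 rfl⟩ hc' hd'
      ⟨u, hc'u, hd'u⟩ hc'p hd'q rfl

end IsElementary

/-- The vectors of `L` supported in `S`. For the flows of a matroid, these are the flows of the
restriction to `S`. -/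
def supportedOn (L : AddSubgroup (E → ℤ)) (S : Set E) : AddSubgroup (E → ℤ) where
  carrier := {x | x ∈ L ∧ support x ⊆ S}
  zero_mem' := ⟨zero_mem L, by simp⟩
  add_mem' hx hy := ⟨add_mem hx.1 hy.1, (support_add _ _).trans (Set.union_subset hx.2 hy.2)⟩
  neg_mem' hx := ⟨neg_mem hx.1, by simpa using hx.2⟩

/-- The vectors `x` for which `K` contains a vector agreeing with `x` on the part of the support of
`c` where `c' = c` and vanishing on the rest of it. It is used to split vectors of `K` along the two
parts. -/
def splittable (K : AddSubgroup (E → ℤ)) (c c' : E → ℤ) : AddSubgroup (E → ℤ) where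
  carrier := {x | ∃ y ∈ K, ∀ e, c e ≠ 0 → y e = if c' e = c e then x e else 0}
  zero_mem' := ⟨0, zero_mem K, by simp⟩
  add_mem' := by
    rintro x x' ⟨y, hy, hyx⟩ ⟨y', hy', hyx'⟩
    refine ⟨y + y', add_mem hy hy', fun e he => ?_⟩
    rw [Pi.add_apply, hyx e he, hyx' e he]
    split_ifs <;> simp
  neg_mem' := by
    rintro x ⟨y, hy, hyx⟩
    refine ⟨-y, neg_mem hy, fun e he => ?_⟩
    rw [Pi.neg_apply, hyx e he]
    split_ifs <;> simp

section Split

variable {L L' K K' : AddSubgroup (E → ℤ)} {x c c' d : E → ℤ} {e e₀ p q : E} {S T : Set E}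

theorem mem_supportedOn : x ∈ supportedOn L S ↔ x ∈ L ∧ support x ⊆ S := Iff.rfl

theorem supportedOn_mono (h : S ⊆ T) : supportedOn L S ≤ supportedOn L T :=
  fun _ hx => ⟨hx.1, hx.2.trans h⟩

theorem splittable_mono (h : K ≤ K') : splittable K c c' ≤ splittable K' c c' :=
  fun _ ⟨y, hy, hyx⟩ => ⟨y, h hy, hyx⟩

theorem IsRegularLattice.exists_isPrimitive_of_abs_lt [Finite E] (hL : IsRegularLattice L)
    (hx : x ∈ L) (hlt : |x p| < |x q|) :
    ∃ f, IsPrimitive L f ∧ Conforms f x ∧ f p = 0 ∧ f q ≠ 0 := by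
  induction hx using hL.induction_on with
  | zero => simp at hlt
  | step x _ c hc hcx ih =>
    have hp := hc.abs_apply_eq_add hcx p
    have hq := hc.abs_apply_eq_add hcx q
    by_cases hcpq : |c q| ≤ |c p|
    · obtain ⟨f, hf, hfx, hfpq⟩ := ih (by linarith)
      exact ⟨f, hf, hfx.trans (hc.conforms_sub hcx), hfpq⟩
    · have hcq := hc.2 q
      refine ⟨c, hc, hcx, abs_eq_zero.1 ?_, abs_ne_zero.1 ?_⟩ <;>
        linarith [abs_nonneg (c p)]

theorem IsPrimitive.apply_eq_of_conforms (hc : IsPrimitive L c) (hcx : Conforms c x)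
    (hx : |x p| ≤ 1) (hcp : c p ≠ 0) : c p = x p := by
  have := hc.abs_apply_eq_add hcx p
  have := hc.abs_apply_of_ne_zero hcp
  have : (x - c) p = 0 := abs_eq_zero.1 (by linarith [abs_nonneg ((x - c) p)])
  rw [Pi.sub_apply] at this
  linarith

/-- Outside the support of `c`, the vector `-d` splits into the nonzero parts `f` and `-d - f` with
disjoint supports, so that `d` is a combination of vectors with fewer coordinates there. -/
theorem IsPrimitive.exists_split_of_eq_of_eq_neg [Finite E] (hL : IsRegularLattice L)
    (hc : IsPrimitive L c) (he₀ : c e₀ ≠ 0) (hd : d ∈ L) (hd1 : ∀ e, |d e| ≤ 1) (hde₀ : d e₀ = 0)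
    (hcp : c p ≠ 0) (hdp : d p = c p) (hcq : c q ≠ 0) (hdq : d q = -c q) :
    ∃ f ∈ L, f e₀ = 0 ∧ (∀ e, c e = 0 → f e = 0 ∨ f e = -d e) ∧
      (∃ u, c u = 0 ∧ f u ≠ 0) ∧ ∃ v, c v = 0 ∧ d v ≠ 0 ∧ f v = 0 := by
  have hoff : ∀ e, c e = 0 → (c - d) e = -d e := fun e he => by simp [he]
  have hcdp : (c - d) p = 0 := by simp [hdp]
  have hcde₀ : (c - d) e₀ = c e₀ := by simp [hde₀]
  have hcd := sub_mem hc.1.mem hd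
  have hlt : |(c - d) e₀| < |(c - d) q| := by
    rw [hcde₀, Pi.sub_apply, hdq, hc.abs_apply_of_ne_zero he₀, sub_neg_eq_add, ← two_mul, abs_mul,
      hc.abs_apply_of_ne_zero hcq]
    norm_num
  obtain ⟨f, hf, hfx, hfe₀, -⟩ := hL.exists_isPrimitive_of_abs_lt hcd hlt
  have hfd : ∀ e, c e = 0 → f e = 0 ∨ f e = -d e := fun e he => by
    rw [← hoff e he]
    exact or_iff_not_imp_left.2
      (hf.apply_eq_of_conforms hfx (by rw [hoff e he, abs_neg]; exact hd1 e))
  -- A vector of `L` conforming to `c - d` vanishes at `p`, so it cannot be supported inside `c`.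
  have hescape : ∀ y ∈ L, y ≠ 0 → Conforms y (c - d) → ∃ e, c e = 0 ∧ y e ≠ 0 := by
    intro y hy hy0 hyx
    by_contra! hsub
    exact hy0 (hc.1.eq_zero_of_support_subset hy (fun e he h => he (hsub e h)) hcp
      (notMem_support.1 fun h => hyx.support_subset h hcdp))
  obtain ⟨u, hcu, hfu⟩ := hescape f hf.1.mem hf.1.ne_zero hfx
  obtain ⟨v, hcv, hfv⟩ := hescape (c - d - f) (sub_mem hcd hf.1.mem)
    (fun h => he₀ (by simpa [hde₀, hfe₀] using congrFun h e₀)) (hf.conforms_sub hfx)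
  rw [Pi.sub_apply, hoff v hcv] at hfv
  have hfv0 : f v = 0 := (hfd v hcv).resolve_right fun h => hfv (by rw [h, sub_self])
  exact ⟨f, hf.1.mem, hfe₀, hfd, ⟨u, hcu, hfu⟩, v, hcv, by simpa [hfv0] using hfv, hfv0⟩

theorem IsPrimitive.exists_split [Finite E] (hL : IsRegularLattice L)
    (hc : IsPrimitive L c) (he₀ : c e₀ ≠ 0) (hd : d ∈ L) (hd1 : ∀ e, |d e| ≤ 1) (hde₀ : d e₀ = 0)
    (hp : c p * d p ≠ 0) (hq : c q * d q ≠ 0) (hpq : c p * d p ≠ c q * d q) :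
    ∃ f ∈ L, f e₀ = 0 ∧ (∀ e, c e = 0 → f e = 0 ∨ f e = -d e) ∧
      (∃ u, c u = 0 ∧ f u ≠ 0) ∧ ∃ v, c v = 0 ∧ d v ≠ 0 ∧ f v = 0 := by
  have key : ∀ e, c e * d e ≠ 0 → d e = c e ∨ d e = -c e := fun e he => by
    rw [← abs_eq_abs, hc.abs_apply_of_ne_zero (left_ne_zero_of_mul he)]
    exact (hd1 e).antisymm (Int.one_le_abs (right_ne_zero_of_mul he))
  have hc1 : ∀ e, c e * d e ≠ 0 → c e * c e = 1 := fun e he => by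
    rw [← abs_mul_abs_self, hc.abs_apply_of_ne_zero (left_ne_zero_of_mul he), one_mul]
  obtain h | h := key p hp <;> obtain h' | h' := key q hq
  · rw [h, h', hc1 p hp, hc1 q hq] at hpq
    exact absurd rfl hpq
  · exact exists_split_of_eq_of_eq_neg hL hc he₀ hd hd1 hde₀ (left_ne_zero_of_mul hp) h
      (left_ne_zero_of_mul hq) h'
  · exact exists_split_of_eq_of_eq_neg hL hc he₀ hd hd1 hde₀ (left_ne_zero_of_mul hq) h'
      (left_ne_zero_of_mul hp) h
  · rw [h, h', mul_neg, mul_neg, hc1 p hp, hc1 q hq] at hpq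
    exact absurd rfl hpq

theorem IsPrimitive.eq_neg_of_ne (hc : IsPrimitive L c) (hc' : IsPrimitive L' c')
    (hcc' : support c' = support c) (he : c e ≠ 0) (hne : c' e ≠ c e) : c' e = -c e := by
  have he' : c' e ≠ 0 := by rwa [← mem_support, hcc']
  exact (abs_eq_abs.1 (by
    rw [hc.abs_apply_of_ne_zero he, hc'.abs_apply_of_ne_zero he'])).resolve_left hne

theorem mem_splittable_of_split {f : E → ℤ} (hd : d ∈ L) (hde₀ : d e₀ = 0)
    (hdT : support d ⊆ support c ∪ T) (hf : f ∈ L) (hfe₀ : f e₀ = 0)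
    (hfd : ∀ e, c e = 0 → f e = 0 ∨ f e = -d e) (hu : ∃ u, c u = 0 ∧ f u ≠ 0)
    (hv : ∃ v, c v = 0 ∧ d v ≠ 0 ∧ f v = 0)
    (ih : ∀ T' < T, ∀ x ∈ L, x e₀ = 0 → support x ⊆ support c ∪ T' →
      x ∈ splittable (supportedOn L ({e₀}ᶜ ∩ (support c ∪ T'))) c c') :
    d ∈ splittable (supportedOn L ({e₀}ᶜ ∩ (support c ∪ T))) c c' := by
  have hT : ∀ e, c e = 0 → d e ≠ 0 → e ∈ T := fun e hce hde => (hdT hde).resolve_left (· hce)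
  have ih' : ∀ w, c w = 0 → d w ≠ 0 → ∀ x ∈ L, x e₀ = 0 →
      (∀ e, c e = 0 → x e ≠ 0 → d e ≠ 0 ∧ e ≠ w) →
      x ∈ splittable (supportedOn L ({e₀}ᶜ ∩ (support c ∪ T))) c c' := by
    intro w hcw hdw x hx hxe₀ hxw
    refine splittable_mono (supportedOn_mono ?_) (ih (T \ {w}) ?_ x hx hxe₀ fun e he => ?_)
    · exact Set.inter_subset_inter_right _ (Set.union_subset_union_right _ Set.sdiff_subset)
    · exact Set.sdiff_singleton_ssubset.2 (hT w hcw hdw)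
    · refine or_iff_not_imp_left.2 fun hce => ?_
      have := hxw e (notMem_support.1 hce) he
      exact ⟨hT e (notMem_support.1 hce) this.1, this.2⟩
  obtain ⟨u, hcu, hfu⟩ := hu
  obtain ⟨v, hcv, hdv, hfv⟩ := hv
  have hfT := ih' v hcv hdv f hf hfe₀ fun e hce hfe => by
    refine ⟨fun hde => hfe ?_, fun hev => hfe (hev ▸ hfv)⟩
    simpa [hde] using hfd e hce
  have hdfT := ih' u hcu (fun h => hfu (by simpa [h] using hfd u hcu)) (d + f) (add_mem hd hf)
    (by simp [hde₀, hfe₀]) fun e hce hdfe => by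
      obtain h | h := hfd e hce
      · exact ⟨by simpa [h] using hdfe, fun heu => hfu (heu ▸ h)⟩
      · exact absurd (by simp [h]) hdfe
  simpa using sub_mem hdfT hfT

theorem mem_splittable_of_isPrimitive [Finite E] (hL : IsRegularLattice L)
    (hL' : IsRegularLattice L') (hLL' : ∀ x, x e₀ = 0 → (x ∈ L ↔ x ∈ L')) (hc : IsPrimitive L c)
    (hc' : IsPrimitive L' c') (hcc' : support c' = support c) (he₀ : c e₀ ≠ 0)
    (hd : IsPrimitive L d) (hde₀ : d e₀ = 0) (hdT : support d ⊆ support c ∪ T)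
    (ih : ∀ T' < T, ∀ x ∈ L, x e₀ = 0 → support x ⊆ support c ∪ T' →
      x ∈ splittable (supportedOn L ({e₀}ᶜ ∩ (support c ∪ T'))) c c') :
    d ∈ splittable (supportedOn L ({e₀}ᶜ ∩ (support c ∪ T))) c c' := by
  have hdS : d ∈ supportedOn L ({e₀}ᶜ ∩ (support c ∪ T)) :=
    ⟨hd.1.mem, fun e he => ⟨fun h => he (h ▸ hde₀), hdT he⟩⟩
  by_cases hp : ∀ e, c e ≠ 0 → c' e = c e → d e = 0
  · exact ⟨0, zero_mem _, fun e he => by split_ifs with h <;> simp [hp e he, h]⟩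
  by_cases hq : ∀ e, c e ≠ 0 → c' e ≠ c e → d e = 0
  · exact ⟨d, hdS, fun e he => by split_ifs with h <;> simp [hq e he, h]⟩
  push Not at hp hq
  obtain ⟨p, hcp, hc'p, hdp⟩ := hp
  obtain ⟨q, hcq, hc'q, hdq⟩ := hq
  by_cases hpq : c p * d p = c q * d q
  · have hzero : ∀ e, c' e = 0 ↔ c e = 0 := fun e => not_iff_not.1 (Set.ext_iff.1 hcc' e)
    have hneg := hc.eq_neg_of_ne hc' hcc' hcq hc'q
    obtain ⟨f, hf, hfe₀, hfd, hu, hv⟩ := hc'.exists_split hL' (e₀ := e₀) (p := p) (q := q)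
      ((hzero e₀).not.2 he₀) ((hLL' d hde₀).1 hd.1.mem) hd.2 hde₀
      (by rw [hc'p]; exact mul_ne_zero hcp hdp)
      (mul_ne_zero ((hzero q).not.2 hcq) hdq)
      (by rw [hc'p, hneg, hpq, neg_mul]; exact self_ne_neg.2 (mul_ne_zero hcq hdq))
    simp only [hzero] at hfd hu hv
    exact mem_splittable_of_split hd.1.mem hde₀ hdT ((hLL' f hfe₀).2 hf) hfe₀ hfd hu hv ih
  · obtain ⟨f, hf, hfe₀, hfd, hu, hv⟩ := hc.exists_split hL he₀ hd.1.mem hd.2 hde₀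
      (mul_ne_zero hcp hdp) (mul_ne_zero hcq hdq) hpq
    exact mem_splittable_of_split hd.1.mem hde₀ hdT hf hfe₀ hfd hu hv ih

theorem mem_splittable [Finite E] (hL : IsRegularLattice L) (hL' : IsRegularLattice L')
    (hLL' : ∀ x, x e₀ = 0 → (x ∈ L ↔ x ∈ L')) (hc : IsPrimitive L c) (hc' : IsPrimitive L' c')
    (hcc' : support c' = support c) (he₀ : c e₀ ≠ 0) (hx : x ∈ L) (hxe₀ : x e₀ = 0)
    (hxT : support x ⊆ support c ∪ T) :
    x ∈ splittable (supportedOn L ({e₀}ᶜ ∩ (support c ∪ T))) c c' := by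
  induction T using WellFoundedLT.induction generalizing x with
  | _ T ih =>
    induction hx using hL.induction_on with
    | zero => exact zero_mem _
    | step x _ d hd hdx ihx =>
      have hde₀ : d e₀ = 0 := notMem_support.1 fun h => hdx.support_subset h hxe₀
      rw [← sub_add_cancel x d]
      exact add_mem (ihx (by simp [hxe₀, hde₀]) ((hd.conforms_sub hdx).support_subset.trans hxT))
        (mem_splittable_of_isPrimitive hL hL' hLL' hc hc' hcc' he₀ hd hde₀
          (hdx.support_subset.trans hxT) fun T' hT' x hx hxe hxT => ih T' hT' hx hxe hxT)

theorem IsElementary.apply_eq_zero_or_apply_eq_zero [Finite E] (hL : IsRegularLattice L)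
    (hL' : IsRegularLattice L') (hLL' : ∀ x, x e₀ = 0 → (x ∈ L ↔ x ∈ L')) (hc : IsPrimitive L c)
    (hc' : IsPrimitive L' c') (hcc' : support c' = support c) (he₀ : c e₀ ≠ 0)
    (hd : IsElementary L d) (hde₀ : d e₀ = 0) (hp : c p ≠ 0) (hcp : c' p = c p) (hq : c q ≠ 0)
    (hcq : c' q ≠ c q) : d p = 0 ∨ d q = 0 := by
  obtain ⟨y, ⟨hy, hyS⟩, hyd⟩ := mem_splittable (T := support d) hL hL' hLL' hc hc' hcc' he₀
    hd.mem hde₀ Set.subset_union_right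
  refine or_iff_not_imp_right.2 fun hdq => ?_
  have hsub : support y ⊆ support d := fun e he => by
    refine (hyS he).2.elim (fun hce hde => he ?_) id
    rw [hyd e hce, hde, ite_self]
  have hy0 : y = 0 := hd.eq_zero_of_support_subset hy hsub hdq (by rw [hyd q hq, if_neg hcq])
  rw [← hyd p hp |>.trans (if_pos hcp), hy0, Pi.zero_apply]

end Split

section SupportedOn

variable {L L' : AddSubgroup (E → ℤ)} {x : E → ℤ} {S I : Set E}

theorem supportedOn_univ : supportedOn L Set.univ = L := by
  ext x
  simp [mem_supportedOn]

theorem supportedOn_empty : supportedOn L ∅ = ⊥ := by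
  ext x
  simp +contextual [mem_supportedOn, AddSubgroup.mem_bot, L.zero_mem]

theorem supportedOn_supportedOn :
    supportedOn (supportedOn L S) I = supportedOn L (S ∩ I) := by
  ext x
  simp only [mem_supportedOn, Set.subset_inter_iff, and_assoc]

theorem isElementary_supportedOn_iff :
    IsElementary (supportedOn L S) x ↔ IsElementary L x ∧ support x ⊆ S := by
  refine ⟨fun h => ⟨⟨⟨h.mem.1, h.ne_zero⟩, fun y hy hyx => ?_⟩, h.mem.2⟩,
    fun h => ⟨⟨⟨h.1.mem, h.2⟩, h.1.ne_zero⟩, fun y hy hyx => h.1.2 ⟨hy.1.1, hy.2⟩ hyx⟩⟩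
  exact h.2 ⟨⟨hy.1, hyx.trans h.mem.2⟩, hy.2⟩ hyx

theorem isRegularLattice_supportedOn (hL : IsRegularLattice L) (S : Set E) :
    IsRegularLattice (supportedOn L S) := fun x hx => by
  rw [isElementary_supportedOn_iff] at hx
  exact ⟨hL x hx.1, fun e he => hx.2 fun h => he (by simp [h])⟩

theorem flowIndep_supportedOn_iff : FlowIndep (supportedOn L S) I ↔ FlowIndep L (I ∩ S) :=
  ⟨fun h x hx hxI => h x ⟨hx, hxI.trans Set.inter_subset_right⟩ (hxI.trans Set.inter_subset_left),
    fun h x hx hxI => h x hx.1 (Set.subset_inter hxI hx.2)⟩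

theorem IsElementary.exists_support_eq [Finite E] (hx : IsElementary L x)
    (h : ∀ I, FlowIndep L I ↔ FlowIndep L' I) :
    ∃ y, IsElementary L' y ∧ support y = support x := by
  have hdep : ¬ FlowIndep L' (support x) := fun hI =>
    hx.ne_zero ((h _).2 hI x hx.mem subset_rfl)
  simp only [FlowIndep, not_forall] at hdep
  obtain ⟨z, hz, hzx, hz0⟩ := hdep
  obtain ⟨e, he⟩ := ne_iff.1 hz0
  obtain ⟨y, hy, hyz, -⟩ := exists_isElementary_apply_ne_zero hz he
  refine ⟨y, hy, (hyz.trans hzx).antisymm ?_⟩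
  have hdep : ¬ FlowIndep L (support y) := fun hI => hy.ne_zero ((h _).1 hI y hy.mem subset_rfl)
  simp only [FlowIndep, not_forall] at hdep
  obtain ⟨w, hw, hwy, hw0⟩ := hdep
  exact (hx.2 ⟨hw, hw0⟩ (hwy.trans (hyz.trans hzx))).trans hwy

end SupportedOn

section Signs

variable {L L' : AddSubgroup (E → ℤ)} {x : E → ℤ} {S I : Set E} (a : E → ℤˣ)

theorem support_units_smul (x : E → ℤ) : support (a • x) = support x := by
  ext e; simp [Units.smul_def]

theorem IsElementary.units_smul (hx : IsElementary L x) : IsElementary (a • L) (a • x) := by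
  refine ⟨⟨AddSubgroup.smul_mem_pointwise_smul x a L hx.mem, (smul_ne_zero_iff_ne a).2 hx.ne_zero⟩,
    fun y hy hyx => ?_⟩
  rw [support_units_smul] at hyx ⊢
  rw [← support_units_smul a⁻¹ y] at hyx ⊢
  exact hx.2 ⟨AddSubgroup.mem_pointwise_smul_iff_inv_smul_mem.1 hy.1,
    (smul_ne_zero_iff_ne a⁻¹).2 hy.2⟩ hyx

theorem IsRegularLattice.units_smul (hL : IsRegularLattice L) : IsRegularLattice (a • L) := by
  intro x hx
  have hsign := hL _ (by simpa only [inv_smul_smul] using hx.units_smul a⁻¹)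
  rw [AddSubgroup.mem_pointwise_smul_iff_inv_smul_mem]
  convert hsign using 1
  ext e
  obtain h | h := Int.units_eq_one_or (a e) <;> simp [h, Int.sign_neg]

theorem FlowIndep.units_smul (h : FlowIndep L I) : FlowIndep (a • L) I := fun x hx hxI => by
  rw [← smul_eq_zero_iff_eq a⁻¹]
  exact h _ (AddSubgroup.mem_pointwise_smul_iff_inv_smul_mem.1 hx) (by rwa [support_units_smul])

theorem flowIndep_units_smul_iff : FlowIndep (a • L) I ↔ FlowIndep L I :=
  ⟨fun h => by simpa only [inv_smul_smul] using h.units_smul a⁻¹, fun h => h.units_smul a⟩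

theorem units_smul_sup_zmultiples :
    a • (L ⊔ AddSubgroup.zmultiples x) = a • L ⊔ AddSubgroup.zmultiples (a • x) :=
  (AddSubgroup.map_sup _ _ _).trans (congrArg _ (AddMonoidHom.map_zmultiples _ _))

theorem units_smul_supportedOn : a • supportedOn L S = supportedOn (a • L) S := by
  ext x
  simp only [AddSubgroup.mem_pointwise_smul_iff_inv_smul_mem, mem_supportedOn, support_units_smul]

end Signs

section Signing

variable {L L' : AddSubgroup (E → ℤ)} {x c c' d : E → ℤ} {e₀ p q : E}

theorem supportedOn_compl_singleton_eq_iff : supportedOn L {e₀}ᶜ = supportedOn L' {e₀}ᶜ ↔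
    ∀ x, x e₀ = 0 → (x ∈ L ↔ x ∈ L') := by
  simp +contextual [SetLike.ext_iff, mem_supportedOn, Set.subset_compl_singleton_iff]

/-- The coordinates of `c` at which `c'` differs from `c`, together with those joined to one of them
by an elementary vector of `L`. In the application all vectors of `L` vanish at a coordinate where
`c` does not, and changing the signs on this set turns `c` into `c'` and preserves `L`. -/
def flipSet (L : AddSubgroup (E → ℤ)) (c c' : E → ℤ) : Set E :=
  {z | ∃ q, c q ≠ 0 ∧ c' q ≠ c q ∧ (z = q ∨ ∃ d, IsElementary L d ∧ d q ≠ 0 ∧ d z ≠ 0)}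

theorem support_subset_flipSet [Finite E] (hd : IsElementary L d)
    (hp : d p ≠ 0) (hpT : p ∈ flipSet L c c') : support d ⊆ flipSet L c c' := by
  intro z hz
  obtain ⟨q, hcq, hc'q, rfl | ⟨f, hf, hfq, hfp⟩⟩ := hpT
  · exact ⟨p, hcq, hc'q, Or.inr ⟨d, hd, hp, hz⟩⟩
  · obtain ⟨y, hy, hyq, hyz⟩ := hf.exists_apply_ne_zero_and_apply_ne_zero hd ⟨p, hfp, hp⟩ hfq hz
    exact ⟨q, hcq, hc'q, Or.inr ⟨y, hy, hyq, hyz⟩⟩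

open Classical in
/-- The change of signs at the coordinates in `T`, acting on `ℤ^E`. -/
noncomputable def flipSign (T : Set E) (e : E) : ℤˣ := if e ∈ T then -1 else 1

theorem flipSign_smul_le [Finite E] {K : AddSubgroup (E → ℤ)} {T : Set E} (hK : IsRegularLattice K)
    (hT : ∀ d, IsElementary K d → support d ⊆ T ∨ Disjoint (support d) T) :
    flipSign T • K ≤ K := by
  have hprim : ∀ d, IsPrimitive K d → flipSign T • d ∈ K := fun d hd => by
    obtain h | h := hT d hd.1
    · convert neg_mem hd.1.mem using 1
      ext e
      by_cases he : e ∈ T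
      · simp [flipSign, he]
      · simp [flipSign, he, notMem_support.1 fun h' => he (h h')]
    · convert hd.1.mem using 1
      ext e
      by_cases he : e ∈ T
      · simp [flipSign, he, notMem_support.1 fun h' => h.le_bot ⟨h', he⟩]
      · simp [flipSign, he]
  rintro _ ⟨x, hx, rfl⟩
  change flipSign T • x ∈ K
  induction hx using hK.induction_on with
  | zero => rw [smul_zero]; exact zero_mem K
  | step x hx d hd _ ih =>
    rw [← sub_add_cancel x d, smul_add]
    exact add_mem ih (hprim d hd)

theorem units_smul_eq_of_le {K : AddSubgroup (E → ℤ)} {a : E → ℤˣ} (h : a • K ≤ K) : a • K = K := by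
  refine h.antisymm fun x hx => AddSubgroup.mem_pointwise_smul_iff_inv_smul_mem.2 (h ?_)
  rw [show a⁻¹ = a from funext fun e => Int.units_inv_eq_self (a e)]
  exact AddSubgroup.smul_mem_pointwise_smul x a K hx

theorem supportedOn_sup_zmultiples (hc : c ∈ L) (he₀ : |c e₀| = 1) :
    supportedOn L {e₀}ᶜ ⊔ AddSubgroup.zmultiples c = L := by
  refine le_antisymm (sup_le (fun x hx => hx.1) (by simpa using hc)) fun x hx => ?_
  rw [← sub_add_cancel x ((x e₀ * c e₀) • c)]
  refine AddSubgroup.add_mem_sup ⟨sub_mem hx (zsmul_mem hc _), ?_⟩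
    (AddSubgroup.zsmul_mem_zmultiples c _)
  rw [Set.subset_compl_singleton_iff, notMem_support, Pi.sub_apply, Pi.smul_apply, smul_eq_mul,
    mul_assoc, ← abs_mul_abs_self (c e₀), he₀, mul_one, mul_one, sub_self]

theorem flipSign_smul_eq [Finite E] (hL : IsRegularLattice L)
    (hL' : IsRegularLattice L') (hLL' : supportedOn L {e₀}ᶜ = supportedOn L' {e₀}ᶜ)
    (hc : IsPrimitive L c) (hc' : IsPrimitive L' c') (hcc' : support c' = support c)
    (he₀ : c e₀ ≠ 0) :
    flipSign (flipSet (supportedOn L {e₀}ᶜ) c c') • c = c' := by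
  ext z
  rw [Pi.smul_apply', flipSign]
  by_cases hcz : c z = 0
  · have hc'z : c' z = 0 := by rwa [← notMem_support, hcc', notMem_support]
    rw [hcz, smul_zero, hc'z]
  by_cases hc'z : c' z = c z
  · rw [if_neg, one_smul, hc'z]
    rintro ⟨q, hcq, hc'q, rfl | ⟨d, hd, hdq, hdz⟩⟩
    · exact hc'q hc'z
    · rw [isElementary_supportedOn_iff, Set.subset_compl_singleton_iff,
        notMem_support (x := e₀)] at hd
      exact (hd.1.apply_eq_zero_or_apply_eq_zero hL hL'
        (supportedOn_compl_singleton_eq_iff.1 hLL') hc hc' hcc' he₀ hd.2 hcz hc'z hcq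
        hc'q).elim hdz hdq
  · rw [if_pos ⟨z, hcz, hc'z, Or.inl rfl⟩, hc.eq_neg_of_ne hc' hcc' hcz hc'z, Units.neg_smul,
      one_smul]

theorem exists_units_smul_eq_of_isPrimitive [Finite E] (hL : IsRegularLattice L)
    (hL' : IsRegularLattice L') (hLL' : supportedOn L {e₀}ᶜ = supportedOn L' {e₀}ᶜ)
    (hc : IsPrimitive L c) (hc' : IsPrimitive L' c') (hcc' : support c' = support c)
    (he₀ : c e₀ ≠ 0) :
    ∃ a : E → ℤˣ, a • L = L' := by
  have he₀' : c' e₀ ≠ 0 := by rwa [← mem_support, hcc']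
  have hT : ∀ d, IsElementary (supportedOn L {e₀}ᶜ) d →
      support d ⊆ flipSet (supportedOn L {e₀}ᶜ) c c' ∨
      Disjoint (support d) (flipSet (supportedOn L {e₀}ᶜ) c c') := fun d hd =>
    or_iff_not_imp_right.2 fun h => by
      obtain ⟨p, hp, hpT⟩ := Set.not_disjoint_iff.1 h
      exact support_subset_flipSet hd hp hpT
  have hK := units_smul_eq_of_le (flipSign_smul_le (isRegularLattice_supportedOn hL {e₀}ᶜ) hT)
  have hcc := flipSign_smul_eq hL hL' hLL' hc hc' hcc' he₀
  set a := flipSign (flipSet (supportedOn L {e₀}ᶜ) c c')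
  refine ⟨a, ?_⟩
  calc a • L
      = a • (supportedOn L {e₀}ᶜ ⊔ AddSubgroup.zmultiples c) := by
        rw [supportedOn_sup_zmultiples hc.1.mem (hc.abs_apply_of_ne_zero he₀)]
    _ = supportedOn L' {e₀}ᶜ ⊔ AddSubgroup.zmultiples c' := by
        rw [units_smul_sup_zmultiples, hK, hLL', hcc]
    _ = L' := supportedOn_sup_zmultiples hc'.1.mem (hc'.abs_apply_of_ne_zero he₀')

theorem exists_units_smul_eq_of_supportedOn_eq [Finite E] (hL : IsRegularLattice L)
    (hL' : IsRegularLattice L') (hLL' : supportedOn L {e₀}ᶜ = supportedOn L' {e₀}ᶜ)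
    (h : ∀ I, FlowIndep L I ↔ FlowIndep L' I) : ∃ a : E → ℤˣ, a • L = L' := by
  by_cases hx : ∃ x ∈ L, x e₀ ≠ 0
  · obtain ⟨x, hx, hxe₀⟩ := hx
    obtain ⟨c, hc, -, he₀⟩ := hL.exists_isPrimitive_apply_ne_zero hx hxe₀
    obtain ⟨y, hy, hyc⟩ := hc.1.exists_support_eq h
    obtain ⟨c', hc', hc'y, -⟩ := hL'.exists_isPrimitive_of_isElementary hy
    exact exists_units_smul_eq_of_isPrimitive hL hL' hLL' hc hc' (hc'y.trans hyc) he₀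
  · have hx' : ∀ x ∈ L', x e₀ = 0 := by
      by_contra! hx'
      obtain ⟨x', hx', hxe₀'⟩ := hx'
      obtain ⟨y', hy', -, hye₀'⟩ := exists_isElementary_apply_ne_zero hx' hxe₀'
      obtain ⟨y, hy, hyy'⟩ := hy'.exists_support_eq fun I => (h I).symm
      exact hx ⟨y, hy.mem, by rwa [← mem_support, hyy']⟩
    push Not at hx
    rw [supportedOn_compl_singleton_eq_iff] at hLL'
    refine ⟨1, ?_⟩
    rw [one_smul]
    ext x
    exact ⟨fun hxL => (hLL' x (hx x hxL)).1 hxL, fun hxL' => (hLL' x (hx' x hxL')).2 hxL'⟩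

theorem IsRegularLattice.exists_units_smul_eq [Finite E] (hL : IsRegularLattice L)
    (hL' : IsRegularLattice L') (h : ∀ I, FlowIndep L I ↔ FlowIndep L' I) :
    ∃ a : E → ℤˣ, a • L = L' := by
  suffices hS : ∀ S : Set E, ∃ a : E → ℤˣ, a • supportedOn L S = supportedOn L' S by
    simpa only [supportedOn_univ] using hS Set.univ
  intro S
  induction S, S.toFinite using Set.Finite.induction_on with
  | empty => exact ⟨1, by rw [one_smul, supportedOn_empty, supportedOn_empty]⟩
  | @insert e S heS _ ih =>
    obtain ⟨a, ha⟩ := ih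
    have hinter : S = insert e S ∩ {e}ᶜ := by simp [Set.insert_inter_of_notMem, heS]
    obtain ⟨b, hb⟩ := exists_units_smul_eq_of_supportedOn_eq (e₀ := e)
      ((isRegularLattice_supportedOn hL (insert e S)).units_smul a)
      (isRegularLattice_supportedOn hL' (insert e S))
      (by rw [← units_smul_supportedOn, supportedOn_supportedOn, supportedOn_supportedOn,
            ← hinter, ha])
      fun I => by
        rw [flowIndep_units_smul_iff, flowIndep_supportedOn_iff, flowIndep_supportedOn_iff, h]
    exact ⟨b * a, by rw [mul_smul, hb]⟩

end Signing

/-- The lattice of the vectors `x ∘ ι`, with `x ∈ L`: for injective `ι`, the restrictions of the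
vectors of `L` to the coordinates in the range of `ι`. -/
def pullback (L : AddSubgroup (E → ℤ)) (ι : G → E) : AddSubgroup (G → ℤ) :=
  L.map (LinearMap.funLeft ℤ ℤ ι).toAddMonoidHom

section Pullback

variable {L : AddSubgroup (E → ℤ)} {x : E → ℤ} {ι : G → E} {I : Set G}

theorem mem_pullback {y : G → ℤ} : y ∈ pullback L ι ↔ ∃ x ∈ L, x ∘ ι = y := Iff.rfl

theorem support_eq_image_of_subset_range (hx : support x ⊆ Set.range ι) :
    support x = ι '' support (x ∘ ι) := by
  rw [support_comp_eq_preimage, Set.image_preimage_eq_of_subset hx]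

theorem support_comp_subset_iff (hι : Injective ι) (hx : support x ⊆ Set.range ι) :
    support (x ∘ ι) ⊆ I ↔ support x ⊆ ι '' I := by
  rw [support_eq_image_of_subset_range hx, Set.image_subset_image_iff hι]

theorem comp_eq_zero_iff (hx : support x ⊆ Set.range ι) : x ∘ ι = 0 ↔ x = 0 := by
  rw [← support_eq_empty_iff (f := x), support_eq_image_of_subset_range hx, Set.image_eq_empty,
    support_eq_empty_iff]

theorem isRegularLattice_pullback (hL : IsRegularLattice L)
    (hLι : ∀ x ∈ L, support x ⊆ Set.range ι) : IsRegularLattice (pullback L ι) := by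
  intro y hy
  obtain ⟨x, hx, rfl⟩ := hy.mem
  refine ⟨_, hL x ⟨⟨hx, fun h => hy.ne_zero (by rw [h]; rfl)⟩, fun z hz hzx => ?_⟩, rfl⟩
  have hzy := hy.2 ⟨⟨z, hz.1, rfl⟩, (comp_eq_zero_iff (hLι z hz.1)).not.2 hz.2⟩
    (Set.preimage_mono hzx)
  change support x ⊆ support z
  rw [support_eq_image_of_subset_range (hLι x hx), support_eq_image_of_subset_range (hLι z hz.1)]
  exact Set.image_mono hzy

theorem flowIndep_pullback_iff (hι : Injective ι) (hLι : ∀ x ∈ L, support x ⊆ Set.range ι) :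
    FlowIndep (pullback L ι) I ↔ FlowIndep L (ι '' I) := by
  simp only [FlowIndep, mem_pullback, forall_exists_index, and_imp, forall_apply_eq_imp_iff₂]
  refine forall₂_congr fun x hx => ?_
  rw [support_comp_subset_iff hι (hLι x hx), comp_eq_zero_iff (hLι x hx)]

end Pullback

section Isometry

variable {L : AddSubgroup (E → ℤ)} {L' : AddSubgroup (F → ℤ)} {L'' : AddSubgroup (G → ℤ)}

theorem flowIndep_iff_of_abs_apply_eq (ψ : L ≃+ L') (φ : E ≃ F)
    (hφ : ∀ (x : L) e, |(ψ x : F → ℤ) (φ e)| = |(x : E → ℤ) e|) (I : Set E) :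
    FlowIndep L I ↔ FlowIndep L' (φ '' I) := by
  have hsupp (x : L) : support (x : E → ℤ) = φ ⁻¹' support (ψ x : F → ℤ) := by
    ext e
    rw [mem_support, Set.mem_preimage, mem_support, ← abs_ne_zero, ← hφ, abs_ne_zero]
  calc FlowIndep L I
      ↔ ∀ x : L, support (x : E → ℤ) ⊆ I → x = 0 := by simp [FlowIndep]
    _ ↔ ∀ x : L, support (ψ x : F → ℤ) ⊆ φ '' I → ψ x = 0 := by
      refine forall_congr' fun x => ?_
      rw [← φ.surjective.preimage_subset_preimage_iff, ← hsupp, φ.preimage_image,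
        map_eq_zero_iff ψ ψ.injective]
    _ ↔ ∀ y : L', support (y : F → ℤ) ⊆ φ '' I → y = 0 :=
      (ψ.surjective.forall (p := fun y : L' => support (y : F → ℤ) ⊆ φ '' I → y = 0)).symm
    _ ↔ FlowIndep L' (φ '' I) := by simp [FlowIndep]

variable [Fintype E] [Fintype F] [Fintype G]

theorem LatticesIsometric.symm (h : LatticesIsometric L L') : LatticesIsometric L' L := by
  obtain ⟨ψ, hψ⟩ := h
  exact ⟨ψ.symm, fun x y => by rw [← hψ, ψ.apply_symm_apply, ψ.apply_symm_apply]⟩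

theorem LatticesIsometric.trans (h : LatticesIsometric L L') (h' : LatticesIsometric L' L'') :
    LatticesIsometric L L'' := by
  obtain ⟨ψ, hψ⟩ := h
  obtain ⟨ψ', hψ'⟩ := h'
  exact ⟨ψ.trans ψ', fun x y => (hψ' _ _).trans (hψ x y)⟩

theorem latticesIsometric_map {f : (E → ℤ) →+ (F → ℤ)}
    (hf : ∀ x ∈ L, ∀ y ∈ L, f x ⬝ᵥ f y = x ⬝ᵥ y) : LatticesIsometric L (L.map f) := by
  refine ⟨AddEquiv.ofBijective (f.addSubgroupMap L)
    ⟨(injective_iff_map_eq_zero _).2 fun x hx => ?_, f.addSubgroupMap_surjective L⟩,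
    fun x y => hf x x.2 y y.2⟩
  have hfx : f x = 0 := congrArg Subtype.val hx
  rw [← ZeroMemClass.coe_eq_zero, ← dotProduct_self_eq_zero, ← hf x x.2 x x.2, hfx, zero_dotProduct]

theorem latticesIsometric_units_smul (a : E → ℤˣ) : LatticesIsometric L (a • L) :=
  latticesIsometric_map fun x _ y _ => Finset.sum_congr rfl fun e _ => by
    obtain h | h := Int.units_eq_one_or (a e) <;> simp [h]

theorem latticesIsometric_pullback {ι : G → E} (hι : Injective ι)
    (hLι : ∀ x ∈ L, support x ⊆ Set.range ι) : LatticesIsometric L (pullback L ι) :=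
  latticesIsometric_map fun x hx y _ =>
    Fintype.sum_of_injective ι hι _ _
      (fun e he => by rw [notMem_support.1 fun h => he (hLι x hx h), zero_mul]) fun _ => rfl

theorem LatticesIsometric.of_flowIndep_iff (hL : IsRegularLattice L) (hL' : IsRegularLattice L')
    (φ : E ≃ F) (hφ : ∀ I, FlowIndep L I ↔ FlowIndep L' (φ '' I)) : LatticesIsometric L L' := by
  have hLφ : ∀ x ∈ L', support x ⊆ Set.range φ := fun x _ => by
    rw [φ.range_eq_univ]; exact Set.subset_univ _
  obtain ⟨a, ha⟩ := hL.exists_units_smul_eq (isRegularLattice_pullback hL' hLφ) fun I => by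
    rw [hφ, flowIndep_pullback_iff φ.injective hLφ]
  have hiso := latticesIsometric_units_smul (L := L) a
  rw [ha] at hiso
  exact hiso.trans (latticesIsometric_pullback φ.injective hLφ).symm

theorem IsRegularLattice.exists_equiv_abs_apply_eq (hL : IsRegularLattice L)
    (hL' : IsRegularLattice L') (hE : ∀ e, ∃ x ∈ L, x e ≠ 0) (hF : ∀ f, ∃ x ∈ L', x f ≠ 0)
    (ψ : L ≃+ L') (hψ : ∀ x y : L, (ψ x : F → ℤ) ⬝ᵥ (ψ y : F → ℤ) = (x : E → ℤ) ⬝ᵥ (y : E → ℤ)) :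
    ∃ φ : E ≃ F, ∀ (x : L) e, |(ψ x : F → ℤ) (φ e)| = |(x : E → ℤ) e| := by
  have hsum (x : L) : ∑ e, |(x : E → ℤ) e| = ∑ f, |(ψ x : F → ℤ) f| := by
    refine le_antisymm ?_ (hL.sum_abs_map_le (L'.subtype.comp ψ.toAddMonoidHom) (fun x => hψ x x) x)
    simpa using hL'.sum_abs_map_le (L.subtype.comp ψ.symm.toAddMonoidHom)
      (fun y => by simpa using (hψ (ψ.symm y) (ψ.symm y)).symm) (ψ x)
  have hone (e : E) : ∃ x : L, (x : E → ℤ) e = 1 :=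
    let ⟨x, hx, hxe⟩ := hL.exists_apply_eq_one (hE e); ⟨⟨x, hx⟩, hxe⟩
  have hone' (f : F) : ∃ x : L, (ψ x : F → ℤ) f = 1 :=
    let ⟨y, hy, hyf⟩ := hL'.exists_apply_eq_one (hF f); ⟨ψ.symm ⟨y, hy⟩, by simpa using hyf⟩
  obtain ⟨φ, hφ⟩ := exists_equiv_of_sum_eq (linearIndepOn_abs (G := L))
    (g := fun e x => |(x : E → ℤ) e|) (h := fun f x => |(ψ x : F → ℤ) f|)
    (fun e => ⟨(Pi.evalAddMonoidHom _ e).comp L.subtype, hone e, rfl⟩)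
    (fun f => ⟨(Pi.evalAddMonoidHom _ f).comp (L'.subtype.comp ψ.toAddMonoidHom), hone' f, rfl⟩)
    (by ext x; simpa only [Finset.sum_apply] using hsum x)
  exact ⟨φ, fun x e => congrFun (hφ e) x⟩

theorem latticesIsometric_iff (hL : IsRegularLattice L) (hL' : IsRegularLattice L')
    (hE : ∀ e, ∃ x ∈ L, x e ≠ 0) (hF : ∀ f, ∃ x ∈ L', x f ≠ 0) : LatticesIsometric L L' ↔
      ∃ φ : E ≃ F, ∀ I, FlowIndep L I ↔ FlowIndep L' (φ '' I) := by
  refine ⟨fun ⟨ψ, hψ⟩ => ?_, fun ⟨φ, hφ⟩ => .of_flowIndep_iff hL hL' φ hφ⟩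
  obtain ⟨φ, hφ⟩ := hL.exists_equiv_abs_apply_eq hL' hE hF ψ hψ
  exact ⟨φ, flowIndep_iff_of_abs_apply_eq ψ φ hφ⟩

end Isometry

section TotallyUnimodular

variable {m n : Type*} {y : E → ℤ} {e e₀ : E}

theorem exists_submatrix_det_ne_zero {K : Type*} [Field K] [Finite m] [Fintype n] [DecidableEq n]
    {A : Matrix m n K} (hA : LinearIndependent K A.col) :
    ∃ f : n → m, (A.submatrix f id).det ≠ 0 := by
  cases nonempty_fintype m
  obtain ⟨κ, a, -, hspan, hrows⟩ := exists_linearIndependent' K A.row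
  have : Fintype κ := @Fintype.ofFinite κ hrows.finite
  have hrank : A.rank = Fintype.card n := by
    rw [← Matrix.rank_transpose]
    exact LinearIndependent.rank_matrix (M := Aᵀ) hA
  have hcard : Fintype.card n = Fintype.card κ := by
    rw [← hrank, Matrix.rank_eq_finrank_span_row, ← hspan, finrank_span_eq_card hrows]
  let φ : n ≃ κ := Fintype.equivOfCardEq hcard
  have hunit : IsUnit (A.submatrix (a ∘ φ) id) :=
    Matrix.linearIndependent_rows_iff_isUnit.1 (hrows.comp φ φ.injective)
  exact ⟨a ∘ φ, ((Matrix.isUnit_iff_isUnit_det _).1 hunit).ne_zero⟩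

theorem exists_isUnit_submatrix [Finite m] [Fintype n] [DecidableEq n] {A : Matrix m n ℤ}
    (hA : A.IsTotallyUnimodular) (hcol : LinearIndependent ℤ A.col) :
    ∃ f : n → m, IsUnit (A.submatrix f id) := by
  obtain ⟨f, hf⟩ := exists_submatrix_det_ne_zero (A := A.map (Int.cast : ℤ → ℚ))
    ((linearIndependent_algebraMap_comp_iff (R := ℤ) (S := ℚ)).2 hcol)
  refine ⟨f, (Matrix.isUnit_iff_isUnit_det _).2 ?_⟩
  have hdet : (A.submatrix f id).det ≠ 0 := by
    rw [← Int.cast_ne_zero (α := ℚ), Int.cast_det]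
    exact hf
  obtain ⟨σ, hσ⟩ := (Matrix.isTotallyUnimodular_iff_fintype A).1 hA n f id
  rw [← hσ] at hdet ⊢
  cases σ with
  | zero => exact absurd rfl hdet
  | neg => exact isUnit_one.neg
  | pos => exact isUnit_one

theorem dvd_of_mulVec_eq_smul [Finite m] [Fintype n] {A : Matrix m n ℤ}
    (hA : A.IsTotallyUnimodular) (hcol : LinearIndependent ℤ A.col) {k : ℤ} {x : n → ℤ} {b : m → ℤ}
    (hx : A *ᵥ x = k • b) (j : n) : k ∣ x j := by
  classical
  obtain ⟨f, hf⟩ := exists_isUnit_submatrix hA hcol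
  set P := A.submatrix f id
  have hPx : P *ᵥ x = k • (b ∘ f) := funext fun j => congrFun hx (f j)
  have hxk : x = k • (P⁻¹ *ᵥ (b ∘ f)) := by
    rw [← Matrix.mulVec_smul, ← hPx, Matrix.mulVec_mulVec,
      Matrix.nonsing_inv_mul _ ((Matrix.isUnit_iff_isUnit_det _).1 hf), Matrix.one_mulVec]
  exact ⟨_, congrFun hxk j⟩

variable [Fintype E] {A : Matrix m E ℤ}

theorem mem_integerFlows {x : E → ℤ} : x ∈ integerFlows A ↔ A *ᵥ x = 0 := Iff.rfl

theorem mulVec_eq_submatrix_mulVec_comp [Fintype n] {ι : n → E} (hι : Injective ι) {x : E → ℤ}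
    (hx : support x ⊆ Set.range ι) : A *ᵥ x = A.submatrix id ι *ᵥ (x ∘ ι) :=
  funext fun i => (Fintype.sum_of_injective ι hι _ _
    (fun e he => by rw [notMem_support.1 fun h => he (hx h), mul_zero]) fun _ => rfl).symm

theorem flowIndep_integerFlows_range_iff [Finite n] {ι : n → E} (hι : Injective ι) :
    FlowIndep (integerFlows A) (Set.range ι) ↔ LinearIndependent ℤ (A.submatrix id ι).col := by
  cases nonempty_fintype n
  rw [← Matrix.mulVec_injective_iff, ← Matrix.coe_mulVecLin, injective_iff_map_eq_zero]
  constructor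
  · intro h w hw
    have hsupp : support (extend ι w 0) ⊆ Set.range ι := fun e he => by
      by_contra hemem
      exact he (extend_apply' w (0 : E → ℤ) e hemem)
    have hcomp : extend ι w 0 ∘ ι = w := funext fun i => hι.extend_apply w 0 i
    rw [← hcomp, comp_eq_zero_iff hsupp]
    refine h _ ?_ hsupp
    rwa [mem_integerFlows, mulVec_eq_submatrix_mulVec_comp hι hsupp, hcomp]
  · intro h x hx hxι
    rw [mem_integerFlows, mulVec_eq_submatrix_mulVec_comp hι hxι] at hx
    exact (comp_eq_zero_iff hxι).1 (h _ hx)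

theorem linearIndepOn_col_iff_flowIndep [Finite m] {I : Set E} :
    LinearIndepOn ℝ (A.map (Int.cast : ℤ → ℝ)).col I ↔ FlowIndep (integerFlows A) I := by
  rw [← Subtype.range_coe (s := I), flowIndep_integerFlows_range_iff Subtype.val_injective,
    Subtype.range_coe, ← linearIndependent_algebraMap_comp_iff (R := ℤ) (S := ℝ)]
  rfl

theorem IsElementary.dvd_apply [Finite m] (hA : A.IsTotallyUnimodular)
    (hy : IsElementary (integerFlows A) y) (he₀ : y e₀ ≠ 0) (he : y e ≠ 0) : y e₀ ∣ y e := by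
  classical
  obtain rfl | hee₀ := eq_or_ne e e₀
  · rfl
  let ι : {f // y f ≠ 0 ∧ f ≠ e₀} → E := Subtype.val
  have hι : Injective ι := Subtype.val_injective
  have hrange : Set.range ι = {f | y f ≠ 0 ∧ f ≠ e₀} := Subtype.range_coe
  have hindep : LinearIndependent ℤ (A.submatrix id ι).col := by
    rw [← flowIndep_integerFlows_range_iff hι, hrange]
    exact fun x hx hxy => hy.eq_zero_of_support_subset hx (fun f hf => (hxy hf).1) he₀
      (notMem_support.1 fun h => (hxy h).2 rfl)
  set z := y - Pi.single e₀ (y e₀) with hz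
  have hze (f : E) (hf : f ≠ e₀) : z f = y f := by simp [hz, hf]
  have hzι : support z ⊆ Set.range ι := fun f hf => by
    have hfe₀ : f ≠ e₀ := by rintro rfl; simp [hz] at hf
    exact hrange ▸ ⟨by rwa [← hze f hfe₀], hfe₀⟩
  have hAz : A *ᵥ z = y e₀ • -A.col e₀ := by
    rw [Matrix.mulVec_sub, mem_integerFlows.1 hy.mem, Matrix.mulVec_single, op_smul_eq_smul,
      smul_neg, zero_sub]
  rw [mulVec_eq_submatrix_mulVec_comp hι hzι] at hAz
  rw [← hze e hee₀]
  exact dvd_of_mulVec_eq_smul (hA.submatrix id ι) hindep hAz ⟨e, he, hee₀⟩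

theorem isRegularLattice_integerFlows [Finite m] (hA : A.IsTotallyUnimodular) :
    IsRegularLattice (integerFlows A) := by
  intro y hy
  obtain ⟨e₀, he₀⟩ := ne_iff.1 hy.ne_zero
  have habs : y = |y e₀| • fun e => (y e).sign := by
    ext e
    by_cases he : y e = 0
    · simp [he]
    have habs : |y e₀| = |y e| := by
      rw [Int.abs_eq_natAbs, Int.abs_eq_natAbs, Int.natAbs_eq_iff_associated.2
        (associated_of_dvd_dvd (hy.dvd_apply hA he₀ he) (hy.dvd_apply hA he he₀))]
    rw [Pi.smul_apply, smul_eq_mul, habs, mul_comm, Int.sign_mul_abs]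
  have hker : |y e₀| • (A *ᵥ fun e => (y e).sign) = 0 := by
    rw [← Matrix.mulVec_smul, ← habs, mem_integerFlows.1 hy.mem]
  exact (smul_eq_zero.1 hker).resolve_left (abs_ne_zero.2 he₀)

end TotallyUnimodular

/-- `L` is a lattice of flows of the matroid `M`: a set is independent in `M` exactly when it
supports no nonzero vector of `L`. -/
def IsFlowLattice {α : Type*} (M : Matroid α) (L : AddSubgroup (M.E → ℤ)) : Prop :=
  ∀ I : Set M.E, M.Indep (Subtype.val '' I) ↔ FlowIndep L I

section Matroids

variable {α β : Type*} {M : Matroid α} {N : Matroid β}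

namespace IsFlowLattice

variable {L : AddSubgroup (M.E → ℤ)}

theorem apply_eq_zero_of_mem_coloops [Finite M.E] (hL : IsFlowLattice M L) {e : M.E}
    (he : (e : α) ∈ M.coloops) {x : M.E → ℤ} (hx : x ∈ L) : x e = 0 := by
  by_contra hxe
  obtain ⟨y, hy, -, hye⟩ := exists_isElementary_apply_ne_zero hx hxe
  have hind : FlowIndep L (support y \ {e}) := fun z hz hzy =>
    hy.eq_zero_of_support_subset hz (hzy.trans Set.sdiff_subset) hye
      (notMem_support.1 fun h => (hzy h).2 rfl)
  have hins := Matroid.IsColoop.insert_indep_of_indep he ((hL _).2 hind)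
  rw [← Set.image_insert_eq, hL] at hins
  exact hy.ne_zero (hins y hy.mem (by simp))

theorem mem_coloops_of_forall_apply_eq_zero (hL : IsFlowLattice M L) {e : M.E}
    (he : ∀ x ∈ L, x e = 0) : (e : α) ∈ M.coloops := by
  rw [← Matroid.isColoop_iff_mem_coloops, Matroid.isColoop_iff_forall_mem_isBase]
  intro B hB
  refine hB.mem_of_insert_indep ?_
  lift B to Set M.E using hB.subset_ground
  rw [← Set.image_insert_eq, hL]
  refine fun x hx hxB => (hL B).1 hB.indep x hx ?_
  rwa [Set.subset_insert_iff_of_notMem (by simpa using he x hx)] at hxB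

theorem isIsomorphic_iff {L' : AddSubgroup (N.E → ℤ)} (hL : IsFlowLattice M L)
    (hL' : IsFlowLattice N L') :
    M.IsIsomorphic N ↔ ∃ φ : M.E ≃ N.E, ∀ I, FlowIndep L I ↔ FlowIndep L' (φ '' I) :=
  exists_congr fun φ => forall_congr' fun I => by rw [hL, hL']

end IsFlowLattice

/-- The inclusion of the ground set of `M.contractColoops` in that of `M`, along which the flows of
`M` are restricted. -/
def contractColoopsInclusion (M : Matroid α) : M.contractColoops.E → M.E :=
  fun e => ⟨e, e.2.1⟩

theorem contractColoopsInclusion_injective : Injective (contractColoopsInclusion M) :=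
  fun _ _ h => Subtype.ext (Subtype.mk.inj h)

instance finite_contractColoops_ground [Finite M.E] : Finite M.contractColoops.E :=
  .of_injective _ contractColoopsInclusion_injective

namespace IsFlowLattice

variable {L : AddSubgroup (M.E → ℤ)}

theorem support_subset_range [Finite M.E] (hL : IsFlowLattice M L) :
    ∀ x ∈ L, support x ⊆ Set.range (contractColoopsInclusion M) :=
  fun _ hx e he => ⟨⟨e, e.2, fun h => he (hL.apply_eq_zero_of_mem_coloops h hx)⟩, rfl⟩

theorem exists_mem_pullback_apply_ne_zero (hL : IsFlowLattice M L) (e : M.contractColoops.E) :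
    ∃ x ∈ pullback L (contractColoopsInclusion M), x e ≠ 0 := by
  by_contra! he
  exact e.2.2 (hL.mem_coloops_of_forall_apply_eq_zero (e := contractColoopsInclusion M e)
    fun x hx => he _ ⟨x, hx, rfl⟩)

theorem contractColoops [Finite M.E] (hL : IsFlowLattice M L) :
    IsFlowLattice M.contractColoops (pullback L (contractColoopsInclusion M)) := by
  intro I
  have hI : Subtype.val '' (contractColoopsInclusion M '' I) = (Subtype.val '' I : Set α) :=
    Set.image_image _ _ _
  have hdisj : Disjoint (Subtype.val '' I : Set α) M.coloops :=
    Set.disjoint_left.2 fun _ ⟨e, _, he⟩ => he ▸ e.2.2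
  rw [flowIndep_pullback_iff contractColoopsInclusion_injective hL.support_subset_range, ← hL, hI]
  exact M.coloops_indep.contract_indep_iff.trans
    (by rw [Matroid.union_coloops_indep_iff, and_iff_right hdisj])

end IsFlowLattice

theorem isFlowLattice_integerFlows [Fintype M.E] {r : ℕ} {A : Matrix (Fin r) M.E ℤ}
    (hA : M.IsTURepresentation A) : IsFlowLattice M (integerFlows A) :=
  fun I => (hA.indep_iff I).trans linearIndepOn_col_iff_flowIndep

theorem latticesIsometric_iff_isIsomorphic_contractColoops [Fintype M.E] [Fintype N.E]
    {L : AddSubgroup (M.E → ℤ)} {L' : AddSubgroup (N.E → ℤ)} (hL : IsRegularLattice L)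
    (hL' : IsRegularLattice L') (hM : IsFlowLattice M L) (hN : IsFlowLattice N L') :
    LatticesIsometric L L' ↔ M.contractColoops.IsIsomorphic N.contractColoops := by
  have := Fintype.ofFinite M.contractColoops.E
  have := Fintype.ofFinite N.contractColoops.E
  have hLiso := latticesIsometric_pullback contractColoopsInclusion_injective
    hM.support_subset_range
  have hLiso' := latticesIsometric_pullback contractColoopsInclusion_injective
    hN.support_subset_range
  calc LatticesIsometric L L'
      ↔ LatticesIsometric (pullback L (contractColoopsInclusion M))
          (pullback L' (contractColoopsInclusion N)) :=
        ⟨fun h => hLiso.symm.trans (h.trans hLiso'), fun h => hLiso.trans (h.trans hLiso'.symm)⟩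
    _ ↔ ∃ φ : M.contractColoops.E ≃ N.contractColoops.E, ∀ I,
          FlowIndep (pullback L (contractColoopsInclusion M)) I ↔
            FlowIndep (pullback L' (contractColoopsInclusion N)) (φ '' I) :=
        latticesIsometric_iff (isRegularLattice_pullback hL hM.support_subset_range)
          (isRegularLattice_pullback hL' hN.support_subset_range)
          hM.exists_mem_pullback_apply_ne_zero hN.exists_mem_pullback_apply_ne_zero
    _ ↔ M.contractColoops.IsIsomorphic N.contractColoops :=
        (hM.contractColoops.isIsomorphic_iff hN.contractColoops).symm

end Matroids

end RegularLattices

/-- Since the lattice of integer flows of a regular matroid is defined through a representing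
totally unimodular matrix, the equivalence is asserted for every choice of such matrices. -/
theorem theorem1 {α β : Type*} (M : Matroid α) (N : Matroid β) [Fintype M.E] [Fintype N.E]
    (hM : M.IsRegular) (hN : N.IsRegular) :
    ∀ (r s : ℕ) (A : Matrix (Fin r) M.E ℤ) (B : Matrix (Fin s) N.E ℤ),
      M.IsTURepresentation A → N.IsTURepresentation B →
        (LatticesIsometric (integerFlows A) (integerFlows B) ↔
          M.contractColoops.IsIsomorphic N.contractColoops) := by
  intro r s A B hA hB
  exact latticesIsometric_iff_isIsomorphic_contractColoops
    (isRegularLattice_integerFlows hA.isTotallyUnimodular)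
    (isRegularLattice_integerFlows hB.isTotallyUnimodular)
    (isFlowLattice_integerFlows hA) (isFlowLattice_integerFlows hB)
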